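/- Let $a_1,a_2\in\mathbb{R}[x]=\mathbb{R}[x_1,\dots,x_n]$, let $\Psi_0,\Psi_1,\Psi_2\subset\mathbb{R}[x]$ be finite sets, and let $$K=\{x\in\mathbb{R}^n:\ p(x)=0\ (p\in\Psi_0),\ q(x)\ge 0\ (q\in\Psi_1),\ q(x)>0\ (q\in\Psi_2)\},$$ $$K_1=\{x\in\mathbb{R}^n:\ p(x)=0\ (p\in\Psi_0),\ q(x)\ge 0\ (q\in\Psi_1\cup\Psi_2)\}.$$ Consider the rational program of minimizing $A(x)=a_1(x)/a_2(x)$ over the points $x\in K$ at which $A$ is defined, i.e. $a_2(x)\neq 0$ (these are all points of $K$ when $a_2>0$ on $K$). Put $d=\max\{\deg a_1,\deg a_2\}$ and $$d_0=\max\{\lceil d/2\rceil,\ \lceil \deg(g)/2\rceil\ (g\in\Psi_0\cup\Psi_1\cup\Psi_2)\}.$$ Let $\mathbb{N}^n_m=\{\alpha\in\mathbb{N}^n:|\alpha|\le m\}$. For $y=(y_\alpha)\in\mathbb{R}^{\mathbb{N}^n_{2k}}$ and $f=\sum_\alpha f_\alpha x^\alpha$ with $\deg f\le 2k$, write $\langle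 f,y\rangle=\sum_\alpha f_\alpha y_\alpha$. The localizing matrix $L_q^{(k)}[y]$ has rows and columns indexed by $\mathbb{N}^n_{s}$, $s=k-\lceil\deg(q)/2\rceil$, with $(\alpha,\beta)$ entry $\langle q\,x^{\alpha+\beta},y\rangle$. For $t\le k$, the moment matrix $M_t[y]$ has entries $y_{\alpha+\beta}$, $\alpha,\beta\in\mathbb{N}^n_t$. Write $[u]_m=(u^\alpha)_{\alpha\in\mathbb{N}^n_m}$ for $u\in\mathbb{R}^n$, and $y|_{m}$ for the restriction of $y$ to $\mathbb{N}^n_m$. For $k\ge d_0$, the $k$th order moment relaxation is $$\min\ \langle a_1,y\rangle\quad\text{s.t.}\quad L_p^{(k)}[y]=0\ (p\in\Psi_0),\ L_q^{(k)}[y]\succeq 0\ (q\in\Psi_1\cup\Psi_2),\ \langle a_2,y\rangle=1,\ M_k[y]\succeq 0,\ y\in\mathbb{R}^{\mathbb{N}^n_{2k}}.$$ Assume $a_2\ge 0$ on $K_1$. Let $y^*$ be a minimizer of the $k$th order moment relaxation such that, for some $t$ with $d_0\le t\le k$, $$r:=\operatorname{rank}M_t[y^*]=\operatorname{rank}M_{t-d_0}[y^*].$$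 Then: 1. If $d_0\ge 1$, there are points $z_1,\dots,z_r\in K_1$ and scalars $\mu_1,\dots,\mu_r>0$ such that $$y^*|_{2t}=\mu_1[z_1]_{2t}+\cdots+\mu_r[z_r]_{2t}.\qquad(*)$$ 2. In every decomposition $(*)$ with $z_1,\dots,z_r\in K_1$ and $\mu_1,\dots,\mu_r>0$, each $z_i$ with $z_i\in K$ and $a_2(z_i)>0$ is a minimizer of the rational program. -/

import Mathlib

namespace MomentRelaxation

/-- The power set `ℕ^n_d` of exponents `α ∈ ℕ^n` with `|α| = α₁ + ⋯ + αₙ ≤ d`. -/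
abbrev Exponents (n d : ℕ) : Type := {α : Fin n →₀ ℕ // α.degree ≤ d}

noncomputable instance instFintypeExponents (n d : ℕ) : Fintype (Exponents n d) :=
  (Finsupp.finite_of_degree_le d).fintype

/-- Truncated multi-sequences (tms) of degree `d` in `n` variables: real vectors
indexed by the exponents of total degree at most `d`. -/
abbrev TMS (n d : ℕ) : Type := Exponents n d → ℝ

/-- The truncation `y|_e` of a tms of degree `d` to a degree `e ≤ d`. -/
def truncate {n d e : ℕ} (h : e ≤ d) (y : TMS n d) : TMS n e :=
  fun α => y ⟨α.1, α.2.trans h⟩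

/-- The tms `[u]_d` of all monomials of degree at most `d` evaluated at the point `u`. -/
def monomialVector {n : ℕ} (d : ℕ) (u : Fin n → ℝ) : TMS n d :=
  fun α => ∏ i, u i ^ α.1 i

/-- The pairing `⟨f, y⟩ = ∑_{|α| ≤ d} f_α y_α` (used for polynomials `f` of degree at
most `d`). -/
noncomputable def pairing {n d : ℕ} (f : MvPolynomial (Fin n) ℝ) (y : TMS n d) : ℝ :=
  ∑ α : Exponents n d, f.coeff α.1 * y α

/-- `⌈deg(q) / 2⌉`. -/
noncomputable def halfDegree {n : ℕ} (q : MvPolynomial (Fin n) ℝ) : ℕ :=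
  (q.totalDegree + 1) / 2

/-- The matrix of the quadratic form `a ↦ ⟨q a², y⟩` on polynomials `a` of degree at most
`s`, in the monomial basis: its entry at `(α, β)` is `⟨q x^α x^β, y⟩`. It is used for
`deg q + 2 s ≤ d`. -/
noncomputable def formMatrix {n d : ℕ} (q : MvPolynomial (Fin n) ℝ) (s : ℕ) (y : TMS n d) :
    Matrix (Exponents n s) (Exponents n s) ℝ :=
  Matrix.of fun α β => pairing (q * MvPolynomial.monomial (α.1 + β.1) 1) y

/-- The `k`th order localizing matrix `L_q^{(k)}[y]`, indexed by the exponents of degree at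
most `k - ⌈deg(q) / 2⌉` (used for `⌈deg(q) / 2⌉ ≤ k` and `2 k ≤ d`). -/
noncomputable def localizingMatrix {n d : ℕ} (q : MvPolynomial (Fin n) ℝ) (k : ℕ)
    (y : TMS n d) :
    Matrix (Exponents n (k - halfDegree q)) (Exponents n (k - halfDegree q)) ℝ :=
  formMatrix q (k - halfDegree q) y

/-- The `t`th order moment matrix `M_t[y]`, the localizing matrix of the constant
polynomial one (used for `2 t ≤ d`). -/
noncomputable def momentMatrix {n d : ℕ} (t : ℕ) (y : TMS n d) :
    Matrix (Exponents n t) (Exponents n t) ℝ :=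
  formMatrix 1 t y

/-- The data of a rational optimization problem: minimize `a₁(x) / a₂(x)` subject to
`p(x) = 0` for `p ∈ Ψ₀`, `q(x) ≥ 0` for `q ∈ Ψ₁` and `q(x) > 0` for `q ∈ Ψ₂`. -/
structure RationalProgram (n : ℕ) where
  /-- numerator -/
  a₁ : MvPolynomial (Fin n) ℝ
  /-- denominator -/
  a₂ : MvPolynomial (Fin n) ℝ
  /-- equality constraints -/
  Ψ₀ : Finset (MvPolynomial (Fin n) ℝ)
  /-- weak inequality constraints -/
  Ψ₁ : Finset (MvPolynomial (Fin n) ℝ)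
  /-- strict inequality constraints -/
  Ψ₂ : Finset (MvPolynomial (Fin n) ℝ)

namespace RationalProgram

variable {n : ℕ} (P : RationalProgram n)

/-- The feasible set `K`. -/
def K : Set (Fin n → ℝ) :=
  {x | (∀ p ∈ P.Ψ₀, MvPolynomial.eval x p = 0) ∧ (∀ q ∈ P.Ψ₁, 0 ≤ MvPolynomial.eval x q) ∧
    ∀ q ∈ P.Ψ₂, 0 < MvPolynomial.eval x q}

/-- The set `K₁`, with every strict inequality replaced by the weak one. -/
def K₁ : Set (Fin n → ℝ) :=
  {x | (∀ p ∈ P.Ψ₀, MvPolynomial.eval x p = 0) ∧ (∀ q ∈ P.Ψ₁, 0 ≤ MvPolynomial.eval x q) ∧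
    ∀ q ∈ P.Ψ₂, 0 ≤ MvPolynomial.eval x q}

/-- The objective `A(x) = a₁(x) / a₂(x)`, meaningful where `a₂(x) ≠ 0`. -/
noncomputable def objective (x : Fin n → ℝ) : ℝ :=
  MvPolynomial.eval x P.a₁ / MvPolynomial.eval x P.a₂

/-- `x` is a minimizer of the rational program: a feasible point at which the objective is
defined, with the least objective value among all such points. If `a₂ > 0` on `K`, these are
just the minimizers of `a₁ / a₂` over `K`. -/
def IsMinimizer (x : Fin n → ℝ) : Prop :=
  x ∈ P.K ∧ MvPolynomial.eval x P.a₂ ≠ 0 ∧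
    ∀ x' ∈ P.K, MvPolynomial.eval x' P.a₂ ≠ 0 → P.objective x ≤ P.objective x'

/-- `d = max {deg a₁, deg a₂}`. -/
noncomputable def d : ℕ := max P.a₁.totalDegree P.a₂.totalDegree

/-- `d₀`, the maximum of `⌈d / 2⌉` and all `⌈deg(g) / 2⌉` for `g ∈ Ψ₀ ∪ Ψ₁ ∪ Ψ₂`. -/
noncomputable def d₀ : ℕ :=
  max ((P.d + 1) / 2)
    (max (P.Ψ₀.sup halfDegree) (max (P.Ψ₁.sup halfDegree) (P.Ψ₂.sup halfDegree)))

/-- Feasible points of the `k`th order moment relaxation (for `k ≥ d₀`). -/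
structure IsMomentFeasible (k : ℕ) (y : TMS n (2 * k)) : Prop where
  eq_zero : ∀ p ∈ P.Ψ₀, localizingMatrix p k y = 0
  posSemidef_weak : ∀ q ∈ P.Ψ₁, (localizingMatrix q k y).PosSemidef
  posSemidef_strict : ∀ q ∈ P.Ψ₂, (localizingMatrix q k y).PosSemidef
  pairing_denominator : pairing P.a₂ y = 1
  posSemidef_moment : (momentMatrix k y).PosSemidef

/-- Minimizers of the `k`th order moment relaxation: minimize `⟨a₁, y⟩` over its feasible
points. -/
def IsMomentMinimizer (k : ℕ) (y : TMS n (2 * k)) : Prop :=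
  P.IsMomentFeasible k y ∧
    ∀ y' : TMS n (2 * k), P.IsMomentFeasible k y' → pairing P.a₁ y ≤ pairing P.a₁ y'

/-- Flat truncation of `y` at the order `t ∈ [d₀, k]`:
`rank M_t[y] = rank M_{t - d₀}[y]`. -/
def IsFlatTruncation {k : ℕ} (t : ℕ) (y : TMS n (2 * k)) : Prop :=
  (momentMatrix t y).rank = (momentMatrix (t - P.d₀) y).rank

/-- The tms `w` is the combination `∑ⱼ μⱼ [zⱼ]` of `r` points `zⱼ ∈ K₁` with
coefficients `μⱼ > 0`. -/
def IsAtomicDecomposition {e r : ℕ} (w : TMS n e) (μ : Fin r → ℝ)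
    (z : Fin r → Fin n → ℝ) : Prop :=
  (∀ j, 0 < μ j) ∧ (∀ j, z j ∈ P.K₁) ∧ w = ∑ j, μ j • monomialVector e (z j)

end RationalProgram

end MomentRelaxation

/-! ### Shift operators and their joint eigenvectors. -/

namespace MomentRelaxation

open Module

/-! Part 1 is a flat-extension argument. Factor `M_t = BᴴB`, so that entries are inner products of
vectors `u α`. Flatness with `d₀ ≥ 1` says degrees at most `t - 1` already span, so multiplication
by each `x_i` acts on the span. These operators are symmetric and commute because inner products
depend only on `α + β`. Joint eigenvalues give the atoms, and squared components of `u 0` the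
weights (`exists_atoms_of_flat`). Since degrees up to `t - d₀` span, each atom is separated from the
others by a polynomial of that degree. Testing the localizing matrices on it gives the sign of each
constraint at the atom (`mem_K₁_of_separating`).

For part 2, let `γ = ⟨a₁, y⟩`. Perturbing `y` by evaluations at points of `K₁` gives `a₁ - γ a₂ ≥ 0`
there (`IsMomentMinimizer.mul_eval_le`). The `μ`-weighted sum of `a₁ - γ a₂` over the atoms is `γ -
γ · 1 = 0`, so every term vanishes, and `A = γ`, a lower bound for `A` on its domain in `K`, at each
atom with `a₂ > 0`. -/

/-- A commuting family of symmetric operators has an orthonormal basis of joint eigenvectors. -/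
theorem exists_orthonormalBasis_jointEigenvectors {ι V : Type*} [NormedAddCommGroup V]
    [InnerProductSpace ℝ V] [FiniteDimensional ℝ V] (T : ι → V →ₗ[ℝ] V)
    (hT : ∀ i, (T i).IsSymmetric) (hC : ∀ i j, Commute (T i) (T j)) :
    ∃ (b : OrthonormalBasis (Fin (finrank ℝ V)) ℝ V) (z : Fin (finrank ℝ V) → ι → ℝ),
      ∀ i j, T i (b j) = z j i • b j := by
  classical
  have horth := LinearMap.IsSymmetric.orthogonalFamily_iInf_eigenspaces hT
  have htop := LinearMap.IsSymmetric.iSup_iInf_eq_top_of_commute hT (fun i j _ => hC i j)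
  let E : (ι → ℝ) → Submodule ℝ V := fun χ => ⨅ i, End.eigenspace (T i) (χ i)
  let w : ∀ χ, OrthonormalBasis (Fin (finrank ℝ (E χ))) ℝ (E χ) :=
    fun χ => stdOrthonormalBasis ℝ (E χ)
  let f : (Σ χ, Fin (finrank ℝ (E χ))) → V := fun a => (w a.1 a.2 : V)
  have hf : Orthonormal ℝ f := horth.orthonormal_sigma_orthonormal (fun χ => (w χ).orthonormal)
  have hspan : ⊤ ≤ Submodule.span ℝ (Set.range f) := by
    rw [← htop]
    refine iSup_le fun χ => ?_
    have h1 : Submodule.map (E χ).subtype (Submodule.span ℝ (Set.range (w χ))) = E χ := by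
      rw [← (w χ).coe_toBasis, (w χ).toBasis.span_eq, Submodule.map_subtype_top]
    change E χ ≤ _
    rw [← h1, Submodule.map_span, Submodule.span_le]
    rintro _ ⟨_, ⟨j, rfl⟩, rfl⟩
    exact Submodule.subset_span ⟨⟨χ, j⟩, rfl⟩
  -- Although `χ` ranges over all of `ι → ℝ`, linear independence leaves only finitely many nonzero
  -- eigenspaces.
  have : Fintype (Σ χ, Fin (finrank ℝ (E χ))) :=
    @Fintype.ofFinite _ hf.linearIndependent.finite
  let b := OrthonormalBasis.mk hf hspan
  have hcard : Fintype.card (Σ χ, Fin (finrank ℝ (E χ))) = finrank ℝ V :=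
    (finrank_eq_card_basis b.toBasis).symm
  let e := Fintype.equivFinOfCardEq hcard
  refine ⟨b.reindex e, fun j => (e.symm j).1, fun i j => ?_⟩
  have h2 : f (e.symm j) ∈ E (e.symm j).1 := (w _ _).2
  have h3 := End.mem_eigenspace_iff.mp ((Submodule.mem_iInf _).mp h2 i)
  simpa [b] using h3

/-- Vectors indexed by exponents whose Gram matrix is a moment matrix, and whose span is already
attained in degree at most `s`, are simultaneously diagonalised by the multiplication operators. -/
theorem exists_orthonormalBasis_of_flat {n s : ℕ} {V : Type*} [NormedAddCommGroup V]
    [InnerProductSpace ℝ V] [FiniteDimensional ℝ V] (u : (Fin n →₀ ℕ) → V)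
    (Y : (Fin n →₀ ℕ) → ℝ)
    (hY : ∀ α β, α.degree ≤ s + 1 → β.degree ≤ s + 1 → inner ℝ (u α) (u β) = Y (α + β))
    (hspan : Submodule.span ℝ (Set.range fun α : Exponents n s => u α.1) = ⊤) :
    ∃ (b : OrthonormalBasis (Fin (finrank ℝ V)) ℝ V) (z : Fin (finrank ℝ V) → Fin n → ℝ),
      ∀ α, α.degree ≤ s + 1 → ∀ j,
        inner ℝ (b j) (u α) = (∏ i, z j i ^ α i) * inner ℝ (b j) (u 0) := by
  classical
  let Φ : (Exponents n s →₀ ℝ) →ₗ[ℝ] V := Finsupp.linearCombination ℝ fun α => u α.1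
  let Ψ : Fin n → (Exponents n s →₀ ℝ) →ₗ[ℝ] V :=
    fun i => Finsupp.linearCombination ℝ fun α => u (α.1 + Finsupp.single i 1)
  have hdeg : ∀ (α : Exponents n s) (i : Fin n), (α.1 + Finsupp.single i 1).degree ≤ s + 1 := by
    intro α i
    simpa using α.2
  have hΦ : ∀ α, Φ (Finsupp.single α 1) = u α.1 := fun α => by simp [Φ]
  have hΨ : ∀ i α, Ψ i (Finsupp.single α 1) = u (α.1 + Finsupp.single i 1) :=
    fun i α => by simp [Ψ]
  have hbil : ∀ A B C D : (Exponents n s →₀ ℝ) →ₗ[ℝ] V,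
      (∀ α β, inner ℝ (A (Finsupp.single α 1)) (B (Finsupp.single β 1)) =
        inner ℝ (C (Finsupp.single α 1)) (D (Finsupp.single β 1))) →
      ∀ c c', inner ℝ (A c) (B c') = inner ℝ (C c) (D c') := by
    intro A B C D h c c'
    have : (innerₗ V).compl₁₂ A B = (innerₗ V).compl₁₂ C D := by
      ext α β
      simpa using h α β
    exact congr($this c c')
  have hsymm : ∀ i c c', inner ℝ (Ψ i c) (Φ c') = inner ℝ (Φ c) (Ψ i c') := by
    intro i
    refine hbil _ _ _ _ fun α β => ?_
    rw [hΨ, hΦ, hΦ, hΨ, hY _ _ (hdeg α i) (β.2.trans s.le_succ),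
      hY _ _ (α.2.trans s.le_succ) (hdeg β i), add_right_comm, add_assoc]
  have hcomm : ∀ i j c c', inner ℝ (Ψ i c) (Ψ j c') = inner ℝ (Ψ j c) (Ψ i c') := by
    intro i j
    refine hbil _ _ _ _ fun α β => ?_
    rw [hΨ, hΨ, hΨ, hΨ, hY _ _ (hdeg α i) (hdeg β j), hY _ _ (hdeg α j) (hdeg β i)]
    congr 1
    abel
  -- Multiplication by `x_i` is defined through an arbitrary linear section `g` of `Φ`: lift to
  -- coefficients, then shift.
  obtain ⟨g, hg⟩ := Φ.exists_rightInverse_of_surjective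
    ((Finsupp.range_linearCombination ℝ).trans hspan)
  have hg' : ∀ a, Φ (g a) = a := fun a => congr($hg a)
  let T : Fin n → V →ₗ[ℝ] V := fun i => Ψ i ∘ₗ g
  have hTsymm : ∀ i, (T i).IsSymmetric := by
    intro i a b
    have := hsymm i (g a) (g b)
    rwa [hg', hg'] at this
  -- Independence of the section: symmetry moves the shift onto the other argument, where `Φ ∘ g =
  -- id` applies.
  have hTΦ : ∀ i c, T i (Φ c) = Ψ i c := by
    intro i c
    refine ext_inner_right ℝ fun v => ?_
    rw [hTsymm i (Φ c) v]
    have := hsymm i c (g v)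
    rw [hg'] at this
    exact this.symm
  have hTcomm : ∀ i j, Commute (T i) (T j) := by
    intro i j
    refine LinearMap.ext fun a => ext_inner_right ℝ fun v => ?_
    change inner ℝ (T i (T j a)) v = inner ℝ (T j (T i a)) v
    rw [hTsymm i (T j a) v, hTsymm j (T i a) v]
    exact hcomm j i (g a) (g v)
  obtain ⟨b, z, hbz⟩ := exists_orthonormalBasis_jointEigenvectors T hTsymm hTcomm
  refine ⟨b, z, fun α => ?_⟩
  induction hd : α.degree generalizing α with
  | zero =>
    rw [Finsupp.degree_eq_zero_iff] at hd
    simp [hd]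
  | succ m ih =>
    intro hm j
    obtain ⟨i, hi⟩ : ∃ i, α i ≠ 0 := by
      by_contra! h
      rw [show α = 0 from Finsupp.ext h] at hd
      simp at hd
    have hα : α = (α - Finsupp.single i 1) + Finsupp.single i 1 :=
      (tsub_add_cancel_of_le (Finsupp.single_le_iff.mpr (Nat.one_le_iff_ne_zero.mpr hi))).symm
    generalize α - Finsupp.single i 1 = β at hα
    subst hα
    have hβ : β.degree = m := by simpa using hd
    have h1 : u (β + Finsupp.single i 1) = T i (u β) := by
      have hβs : β.degree ≤ s := by omega
      rw [← hΦ ⟨β, hβs⟩, hTΦ, hΨ]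
    rw [h1, ← hTsymm i (b j) (u β), hbz, real_inner_smul_left, ih β hβ (by omega) j, ← mul_assoc]
    congr 1
    simp only [Finsupp.add_apply, pow_add, Finset.prod_mul_distrib]
    rw [mul_comm]
    congr 1
    rw [Finset.prod_eq_single i (fun k _ hk => by simp [hk.symm]) (by simp)]
    simp

end MomentRelaxation

/-! ### Gram matrices, the pairing and form matrices. -/

namespace MomentRelaxation

open Module
open scoped Matrix

open scoped MatrixOrder in
/-- A positive semidefinite real matrix is of the form `BᴴB`. -/
theorem exists_conjTranspose_mul_self_of_posSemidef {ι : Type*} [Fintype ι] [DecidableEq ι]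
    {M : Matrix ι ι ℝ} (hM : M.PosSemidef) : ∃ B : Matrix ι ι ℝ, M = B.conjTranspose * B :=
  CStarAlgebra.nonneg_iff_eq_star_mul_self.mp hM.nonneg

/-- The rank of a Gram matrix is the dimension of the span of the vectors. -/
theorem rank_gram_eq_finrank_span {ι κ : Type*} [Fintype ι] [Fintype κ]
    (v : ι → EuclideanSpace ℝ κ) (M : Matrix ι ι ℝ) (hM : ∀ i j, M i j = inner ℝ (v i) (v j)) :
    M.rank = finrank ℝ (Submodule.span ℝ (Set.range v)) := by
  let A : Matrix κ ι ℝ := Matrix.of fun k i => v i k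
  have hMA : M = A.conjTranspose * A := by
    ext i j
    rw [hM, Matrix.mul_apply, PiLp.inner_apply]
    simp [A, mul_comm]
  rw [hMA, Matrix.rank_conjTranspose_mul_self, Matrix.rank_eq_finrank_span_cols]
  have h : Set.range A.col = (WithLp.linearEquiv 2 ℝ (κ → ℝ)) '' Set.range v := by
    rw [← Set.range_comp]
    rfl
  rw [h, ← LinearEquiv.coe_coe, ← Submodule.map_span]
  exact LinearEquiv.finrank_map_eq _ _

section Pairing

variable {n d : ℕ}

theorem pairing_add_right (f : MvPolynomial (Fin n) ℝ) (y y' : TMS n d) :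
    pairing f (y + y') = pairing f y + pairing f y' := by
  simp [pairing, mul_add, Finset.sum_add_distrib]

theorem pairing_smul_right (f : MvPolynomial (Fin n) ℝ) (c : ℝ) (y : TMS n d) :
    pairing f (c • y) = c * pairing f y := by
  simp [pairing, Finset.mul_sum, mul_left_comm]

theorem pairing_sum_right {ι : Type*} (S : Finset ι) (f : MvPolynomial (Fin n) ℝ)
    (y : ι → TMS n d) : pairing f (∑ j ∈ S, y j) = ∑ j ∈ S, pairing f (y j) := by
  simp only [pairing, Finset.sum_apply, Finset.mul_sum]
  exact Finset.sum_comm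

theorem degree_le_totalDegree {f : MvPolynomial (Fin n) ℝ} {α : Fin n →₀ ℕ}
    (hα : f.coeff α ≠ 0) : α.degree ≤ f.totalDegree :=
  MvPolynomial.le_totalDegree (MvPolynomial.mem_support_iff.mpr hα)

/-- The pairing is a sum over the support of the polynomial. -/
theorem pairing_eq_sum_support {f : MvPolynomial (Fin n) ℝ} (hf : f.totalDegree ≤ d)
    (y : TMS n d) (Y : (Fin n →₀ ℕ) → ℝ) (hY : ∀ α : Exponents n d, y α = Y α.1) :
    pairing f y = ∑ α ∈ f.support, f.coeff α * Y α := by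
  classical
  have h := Finset.sum_subtype (F := instFintypeExponents n d)
    (Finsupp.finite_of_degree_le (σ := Fin n) d).toFinset
    (p := fun α => α.degree ≤ d) (by simp) (fun α => f.coeff α * Y α)
  simp only [pairing, hY]
  rw [← h]
  refine (Finset.sum_subset ?_ ?_).symm
  · intro α hα
    simpa using (degree_le_totalDegree (MvPolynomial.mem_support_iff.mp hα)).trans hf
  · intro α _ hα
    simp [MvPolynomial.notMem_support_iff.mp hα]

theorem pairing_monomialVector {f : MvPolynomial (Fin n) ℝ} (hf : f.totalDegree ≤ d)
    (x : Fin n → ℝ) : pairing f (monomialVector d x) = MvPolynomial.eval x f := by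
  rw [pairing_eq_sum_support hf (monomialVector d x) (fun α => ∏ i, x i ^ α i) (fun _ => rfl),
    MvPolynomial.eval_eq']

theorem pairing_truncate {e : ℕ} (h : e ≤ d) {f : MvPolynomial (Fin n) ℝ}
    (hf : f.totalDegree ≤ e) (y : TMS n d) : pairing f (truncate h y) = pairing f y := by
  classical
  let Y : (Fin n →₀ ℕ) → ℝ := fun α => if hα : α.degree ≤ d then y ⟨α, hα⟩ else 0
  rw [pairing_eq_sum_support hf _ Y (fun α => by simp [Y, truncate, α.2.trans h]),
    pairing_eq_sum_support (hf.trans h) _ Y (fun α => by simp [Y, α.2])]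

theorem totalDegree_monomial_one (α : Fin n →₀ ℕ) :
    (MvPolynomial.monomial α (1 : ℝ)).totalDegree = α.degree :=
  MvPolynomial.totalDegree_monomial α one_ne_zero

theorem pairing_monomial {α : Fin n →₀ ℕ} (hα : α.degree ≤ d) (y : TMS n d) :
    pairing (MvPolynomial.monomial α 1) y = y ⟨α, hα⟩ := by
  classical
  simp only [pairing, MvPolynomial.coeff_monomial, ite_mul, one_mul, zero_mul]
  rw [Finset.sum_eq_single ⟨α, hα⟩ _ (by simp)]
  · simp
  · intro β _ hβ
    exact if_neg fun h => hβ (Subtype.ext h.symm)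

theorem totalDegree_mul_monomial_le {s : ℕ} (q : MvPolynomial (Fin n) ℝ) (α β : Exponents n s) :
    (q * MvPolynomial.monomial (α.1 + β.1) (1 : ℝ)).totalDegree ≤ q.totalDegree + 2 * s := by
  refine (MvPolynomial.totalDegree_mul _ _).trans ?_
  rw [totalDegree_monomial_one, map_add]
  have := α.2
  have := β.2
  omega

theorem formMatrix_add (q : MvPolynomial (Fin n) ℝ) (s : ℕ) (y y' : TMS n d) :
    formMatrix q s (y + y') = formMatrix q s y + formMatrix q s y' := by
  ext α β
  exact pairing_add_right _ _ _

theorem formMatrix_smul (q : MvPolynomial (Fin n) ℝ) (s : ℕ) (c : ℝ) (y : TMS n d) :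
    formMatrix q s (c • y) = c • formMatrix q s y := by
  ext α β
  exact pairing_smul_right _ _ _

theorem formMatrix_sum {ι : Type*} (S : Finset ι) (q : MvPolynomial (Fin n) ℝ) (s : ℕ)
    (y : ι → TMS n d) : formMatrix q s (∑ j ∈ S, y j) = ∑ j ∈ S, formMatrix q s (y j) := by
  ext α β
  rw [Matrix.sum_apply]
  exact pairing_sum_right _ _ _

theorem formMatrix_truncate {e s : ℕ} (h : e ≤ d) {q : MvPolynomial (Fin n) ℝ}
    (hq : q.totalDegree + 2 * s ≤ e) (y : TMS n d) :
    formMatrix q s (truncate h y) = formMatrix q s y := by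
  ext α β
  exact pairing_truncate h ((totalDegree_mul_monomial_le q α β).trans hq) y

/-- Carries positivity and vanishing from order `k` down to lower orders. -/
theorem formMatrix_submatrix {s s' : ℕ} (h : s ≤ s') (q : MvPolynomial (Fin n) ℝ)
    (y : TMS n d) :
    (formMatrix q s' y).submatrix (fun α : Exponents n s => ⟨α.1, α.2.trans h⟩)
      (fun α : Exponents n s => ⟨α.1, α.2.trans h⟩) = formMatrix q s y :=
  rfl

theorem formMatrix_monomialVector {s : ℕ} {q : MvPolynomial (Fin n) ℝ}
    (hq : q.totalDegree + 2 * s ≤ d) (x : Fin n → ℝ) :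
    formMatrix q s (monomialVector d x) =
      MvPolynomial.eval x q • Matrix.vecMulVec (monomialVector s x) (monomialVector s x) := by
  ext α β
  change pairing _ _ = _
  rw [pairing_monomialVector ((totalDegree_mul_monomial_le q α β).trans hq)]
  simp [Matrix.vecMulVec_apply, monomialVector, MvPolynomial.eval_monomial, Finsupp.prod_fintype,
    pow_add, Finset.prod_mul_distrib]

theorem dotProduct_formMatrix_monomialVector {s : ℕ} {q : MvPolynomial (Fin n) ℝ}
    (hq : q.totalDegree + 2 * s ≤ d) (x : Fin n → ℝ) (c : Exponents n s → ℝ) :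
    c ⬝ᵥ formMatrix q s (monomialVector d x) *ᵥ c =
      MvPolynomial.eval x q * (c ⬝ᵥ monomialVector s x) ^ 2 := by
  rw [formMatrix_monomialVector hq, Matrix.smul_mulVec, dotProduct_smul, Matrix.vecMulVec_mulVec,
    dotProduct_smul]
  simp [sq, dotProduct_comm]

theorem posSemidef_formMatrix_monomialVector {s : ℕ} {q : MvPolynomial (Fin n) ℝ}
    (hq : q.totalDegree + 2 * s ≤ d) {x : Fin n → ℝ} (hx : 0 ≤ MvPolynomial.eval x q) :
    (formMatrix q s (monomialVector d x)).PosSemidef := by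
  rw [formMatrix_monomialVector hq]
  simpa using (Matrix.posSemidef_vecMulVec_self_star (monomialVector s x)).smul hx

theorem formMatrix_one_apply {s : ℕ} (y : TMS n d) (α β : Exponents n s)
    (h : (α.1 + β.1).degree ≤ d) : formMatrix 1 s y α β = y ⟨α.1 + β.1, h⟩ := by
  simp only [formMatrix, Matrix.of_apply, one_mul]
  exact pairing_monomial h y

end Pairing

end MomentRelaxation

/-! ### Atoms of a flat moment matrix. -/

namespace MomentRelaxation

open Module
open scoped Matrix

/-- Ensures that every coordinate of `y` occurs as an entry of `M_t[y]`, so the Gram vectors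
determine `y`. -/
theorem exists_add_of_degree_le {n t : ℕ} (α : Exponents n (2 * t)) :
    ∃ β γ : Exponents n t, α.1 = β.1 + γ.1 := by
  rcases le_total α.1.degree t with h | h
  · exact ⟨⟨α.1, h⟩, ⟨0, by simp⟩, by simp⟩
  · obtain ⟨β, hβ, hd⟩ := Finsupp.exists_le_degree_eq α.1 t h
    have hα : α.1 = β + (α.1 - β) := (add_tsub_cancel_of_le hβ).symm
    refine ⟨⟨β, hd.le⟩, ⟨α.1 - β, ?_⟩, hα⟩
    have h1 := congrArg Finsupp.degree hα
    rw [map_add] at h1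
    have h2 := α.2
    omega

theorem momentMatrix_apply {n d t : ℕ} (h : 2 * t ≤ d) (y : TMS n d) (α β : Exponents n t) :
    momentMatrix t y α β = y ⟨α.1 + β.1, by
      rw [map_add]; have := α.2; have := β.2; omega⟩ :=
  formMatrix_one_apply y α β _

/-- A truncated multi-sequence with a flat positive semidefinite moment matrix is a positive
combination of as many point evaluations as its rank, and these points are separated, with unit
weight, by polynomials of the lower degree. -/
theorem exists_atoms_of_flat {n s t : ℕ} (hst : s + 1 ≤ t) (y : TMS n (2 * t))
    (hpsd : (momentMatrix t y).PosSemidef)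
    (hrank : (momentMatrix t y).rank = (momentMatrix s y).rank) :
    ∃ (μ : Fin (momentMatrix t y).rank → ℝ) (z : Fin (momentMatrix t y).rank → Fin n → ℝ),
      (∀ j, 0 < μ j) ∧ y = ∑ j, μ j • monomialVector (2 * t) (z j) ∧
      ∀ j, ∃ c : Exponents n s → ℝ, ∀ l,
        μ l * (c ⬝ᵥ monomialVector s (z l)) ^ 2 = if l = j then 1 else 0 := by
  classical
  have hst' : s ≤ t := by omega
  obtain ⟨B, hB⟩ := exists_conjTranspose_mul_self_of_posSemidef hpsd
  let v : Exponents n t → EuclideanSpace ℝ (Exponents n t) := fun α => WithLp.toLp 2 (B.col α)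
  have hv : ∀ α β, momentMatrix t y α β = inner ℝ (v α) (v β) := by
    intro α β
    rw [hB, Matrix.mul_apply, PiLp.inner_apply]
    simp [v, mul_comm]
  let incl : Exponents n s → Exponents n t := fun α => ⟨α.1, α.2.trans hst'⟩
  let V := Submodule.span ℝ (Set.range v)
  have hVrank : (momentMatrix t y).rank = finrank ℝ V := rank_gram_eq_finrank_span v _ hv
  have hVs : Submodule.span ℝ (Set.range (v ∘ incl)) = V := by
    refine Submodule.eq_of_le_of_finrank_eq
      (Submodule.span_mono (Set.range_comp_subset_range _ _)) ?_
    rw [← hVrank, hrank]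
    exact (rank_gram_eq_finrank_span (v ∘ incl) _ fun α β => hv (incl α) (incl β)).symm
  let u : (Fin n →₀ ℕ) → V := fun α =>
    if hα : α.degree ≤ t then ⟨v ⟨α, hα⟩, Submodule.subset_span ⟨_, rfl⟩⟩ else 0
  have hu : ∀ α : Exponents n t, (u α.1 : EuclideanSpace ℝ (Exponents n t)) = v α :=
    fun α => by simp [u, α.2]
  have hus : Submodule.span ℝ (Set.range fun α : Exponents n s => u α.1) = ⊤ := by
    apply Submodule.map_injective_of_injective V.injective_subtype
    rw [Submodule.map_span, Submodule.map_subtype_top, ← Set.range_comp]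
    refine Eq.trans ?_ hVs
    congr 2
    funext α
    exact hu (incl α)
  let Y : (Fin n →₀ ℕ) → ℝ := fun α => if hα : α.degree ≤ 2 * t then y ⟨α, hα⟩ else 0
  have hY : ∀ α β, α.degree ≤ t → β.degree ≤ t → inner ℝ (u α) (u β) = Y (α + β) := by
    intro α β hα hβ
    have h1 : (α + β).degree ≤ 2 * t := by rw [map_add]; omega
    rw [Submodule.coe_inner, hu ⟨α, hα⟩, hu ⟨β, hβ⟩, ← hv, momentMatrix_apply le_rfl]
    simp only [Y, dif_pos h1]
  -- The shifts act on degrees up to `m = t - 1`, so that shifted exponents stay within `t`; `s ≤ m`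
  -- makes those degrees span.
  obtain ⟨m, rfl⟩ : ∃ m, t = m + 1 := ⟨t - 1, by omega⟩
  have hsm : s ≤ m := by omega
  have hum : Submodule.span ℝ (Set.range fun α : Exponents n m => u α.1) = ⊤ := by
    rw [eq_top_iff, ← hus]
    apply Submodule.span_mono
    rintro _ ⟨α, rfl⟩
    exact ⟨⟨α.1, α.2.trans hsm⟩, rfl⟩
  obtain ⟨b, z, hb⟩ := exists_orthonormalBasis_of_flat u Y hY hum
  rw [hVrank]
  -- Expanding `b j` in the `u α` with `|α| ≤ s` gives the coefficients of the separating
  -- polynomial; pairing with `b l` evaluates it at `z l`.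
  have hsep : ∀ j, ∃ c : Exponents n s → ℝ, ∀ l,
      (c ⬝ᵥ monomialVector s (z l)) * inner ℝ (b l) (u 0) = if l = j then 1 else 0 := by
    intro j
    have hj : b j ∈ Submodule.span ℝ (Set.range fun α : Exponents n s => u α.1) := by
      rw [hus]; trivial
    obtain ⟨c, hc⟩ := (Submodule.mem_span_range_iff_exists_fun ℝ).mp hj
    refine ⟨c, fun l => ?_⟩
    rw [← orthonormal_iff_ite.mp b.orthonormal l j, ← hc, inner_sum, dotProduct, Finset.sum_mul]
    refine Finset.sum_congr rfl fun α _ => ?_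
    rw [real_inner_smul_right, hb α.1 (α.2.trans hst') l, mul_assoc]
    rfl
  refine ⟨fun l => inner ℝ (b l) (u 0) ^ 2, z, fun l => ?_, ?_, fun j => ?_⟩
  · obtain ⟨c, hc⟩ := hsep l
    have := hc l
    rw [if_pos rfl] at this
    exact sq_pos_of_ne_zero (right_ne_zero_of_mul (this.trans_ne one_ne_zero))
  · funext α
    obtain ⟨β, γ, h⟩ := exists_add_of_degree_le α
    have h1 : y α = inner ℝ (u β.1) (u γ.1) := by
      rw [hY _ _ β.2 γ.2, ← h]
      simp [Y, α.2]
    -- Parseval in the eigenbasis yields the atomic sum.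
    rw [h1, ← b.sum_inner_mul_inner, Finset.sum_apply]
    refine Finset.sum_congr rfl fun l _ => ?_
    rw [real_inner_comm, hb _ β.2, hb _ γ.2]
    simp only [Pi.smul_apply, smul_eq_mul, monomialVector, h, Finsupp.add_apply, pow_add,
      Finset.prod_mul_distrib]
    ring
  · obtain ⟨c, hc⟩ := hsep j
    refine ⟨c, fun l => ?_⟩
    rw [mul_comm, ← mul_pow, hc]
    split_ifs <;> simp

theorem totalDegree_le_two_mul_halfDegree {n : ℕ} (q : MvPolynomial (Fin n) ℝ) :
    q.totalDegree ≤ 2 * halfDegree q := by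
  unfold halfDegree
  omega

/-- The quadratic form of an atomic truncated multi-sequence at the coefficients of a polynomial
separating an atom is the value of the weight at that atom. -/
theorem dotProduct_formMatrix_of_separating {n d s r : ℕ} {μ : Fin r → ℝ}
    {z : Fin r → Fin n → ℝ} {q : MvPolynomial (Fin n) ℝ} (hq : q.totalDegree + 2 * s ≤ d)
    {c : Exponents n s → ℝ} {j : Fin r}
    (hc : ∀ l, μ l * (c ⬝ᵥ monomialVector s (z l)) ^ 2 = if l = j then 1 else 0) :
    c ⬝ᵥ formMatrix q s (∑ j, μ j • monomialVector d (z j)) *ᵥ c = MvPolynomial.eval (z j) q := by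
  simp only [formMatrix_sum, formMatrix_smul, Matrix.sum_mulVec, dotProduct_sum,
    Matrix.smul_mulVec, dotProduct_smul, dotProduct_formMatrix_monomialVector hq, smul_eq_mul]
  simp only [mul_left_comm (μ _), hc]
  simp

/-! ### Atoms in `K₁` and the lower bound from the relaxation. -/

namespace RationalProgram

variable {n : ℕ} (P : RationalProgram n)

theorem totalDegree_numerator_le : P.a₁.totalDegree ≤ 2 * P.d₀ := by
  have h1 : P.a₁.totalDegree ≤ P.d := le_max_left _ _
  have h2 : (P.d + 1) / 2 ≤ P.d₀ := le_max_left _ _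
  omega

theorem totalDegree_denominator_le : P.a₂.totalDegree ≤ 2 * P.d₀ := by
  have h1 : P.a₂.totalDegree ≤ P.d := le_max_right _ _
  have h2 : (P.d + 1) / 2 ≤ P.d₀ := le_max_left _ _
  omega

variable {P}

theorem halfDegree_le_of_mem {q : MvPolynomial (Fin n) ℝ}
    (hq : q ∈ P.Ψ₀ ∨ q ∈ P.Ψ₁ ∨ q ∈ P.Ψ₂) : halfDegree q ≤ P.d₀ := by
  unfold d₀
  rcases hq with hq | hq | hq
  · exact (Finset.le_sup hq).trans ((le_max_left _ _).trans (le_max_right _ _))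
  · exact (Finset.le_sup hq).trans
      ((le_max_left _ _).trans ((le_max_right _ _).trans (le_max_right _ _)))
  · exact (Finset.le_sup hq).trans
      ((le_max_right _ _).trans ((le_max_right _ _).trans (le_max_right _ _)))

theorem totalDegree_add_le {k : ℕ} (hk : P.d₀ ≤ k) {q : MvPolynomial (Fin n) ℝ}
    (hq : q ∈ P.Ψ₀ ∨ q ∈ P.Ψ₁ ∨ q ∈ P.Ψ₂) :
    q.totalDegree + 2 * (k - halfDegree q) ≤ 2 * k := by
  have h1 := halfDegree_le_of_mem hq
  have h2 := totalDegree_le_two_mul_halfDegree q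
  omega

theorem K_subset_K₁ : P.K ⊆ P.K₁ := fun _ hx => ⟨hx.1, hx.2.1, fun q hq => (hx.2.2 q hq).le⟩

/-- Atoms separated by polynomials of degree at most `t - d₀` lie in `K₁`. -/
theorem mem_K₁_of_separating {k t r : ℕ} (hd₀t : P.d₀ ≤ t) (htk : t ≤ k)
    {y : TMS n (2 * k)} (hy : P.IsMomentFeasible k y) {μ : Fin r → ℝ} {z : Fin r → Fin n → ℝ}
    (hyz : truncate (Nat.mul_le_mul_left 2 htk) y = ∑ j, μ j • monomialVector (2 * t) (z j))
    {j : Fin r} {c : Exponents n (t - P.d₀) → ℝ}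
    (hc : ∀ l, μ l * (c ⬝ᵥ monomialVector (t - P.d₀) (z l)) ^ 2 = if l = j then 1 else 0) :
    z j ∈ P.K₁ := by
  have hle : ∀ {q}, (q ∈ P.Ψ₀ ∨ q ∈ P.Ψ₁ ∨ q ∈ P.Ψ₂) → t - P.d₀ ≤ k - halfDegree q := by
    intro q hq
    have := halfDegree_le_of_mem hq
    omega
  have heval : ∀ {q}, (q ∈ P.Ψ₀ ∨ q ∈ P.Ψ₁ ∨ q ∈ P.Ψ₂) →
      MvPolynomial.eval (z j) q = c ⬝ᵥ formMatrix q (t - P.d₀) y *ᵥ c := by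
    intro q hq
    have hdeg : q.totalDegree + 2 * (t - P.d₀) ≤ 2 * t := by
      have h1 := halfDegree_le_of_mem hq
      have h2 := totalDegree_le_two_mul_halfDegree q
      omega
    rw [← formMatrix_truncate (Nat.mul_le_mul_left 2 htk) hdeg, hyz,
      dotProduct_formMatrix_of_separating hdeg hc]
  have hnonneg : ∀ {q}, (q ∈ P.Ψ₀ ∨ q ∈ P.Ψ₁ ∨ q ∈ P.Ψ₂) →
      (localizingMatrix q k y).PosSemidef → 0 ≤ MvPolynomial.eval (z j) q := by
    intro q hq hL
    rw [heval hq, ← formMatrix_submatrix (hle hq)]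
    simpa [localizingMatrix] using (hL.submatrix _).dotProduct_mulVec_nonneg c
  refine ⟨fun p hp => ?_, fun q hq => hnonneg (.inr (.inl hq)) (hy.posSemidef_weak q hq),
    fun q hq => hnonneg (.inr (.inr hq)) (hy.posSemidef_strict q hq)⟩
  have h0 : formMatrix p (k - halfDegree p) y = 0 := hy.eq_zero p hp
  rw [heval (.inl hp), ← formMatrix_submatrix (hle (.inl hp)), h0]
  simp

/-- Adding a nonnegative multiple of a point evaluation at a point of `K₁` preserves the
homogeneous constraints of the moment relaxation. -/
theorem IsMomentFeasible.smul_add_smul_monomialVector {k : ℕ} (hk : P.d₀ ≤ k)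
    {y : TMS n (2 * k)} (hy : P.IsMomentFeasible k y) {a c : ℝ} (ha : 0 ≤ a) (hc : 0 ≤ c)
    {x : Fin n → ℝ} (hx : x ∈ P.K₁) (h1 : a + c * MvPolynomial.eval x P.a₂ = 1) :
    P.IsMomentFeasible k (a • y + c • monomialVector (2 * k) x) where
  eq_zero p hp := by
    have h0 : formMatrix p (k - halfDegree p) y = 0 := hy.eq_zero p hp
    rw [localizingMatrix, formMatrix_add, formMatrix_smul, formMatrix_smul, h0,
      formMatrix_monomialVector (totalDegree_add_le hk (.inl hp)), hx.1 p hp]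
    simp
  posSemidef_weak q hq := by
    rw [localizingMatrix, formMatrix_add, formMatrix_smul, formMatrix_smul]
    exact ((hy.posSemidef_weak q hq).smul ha).add ((posSemidef_formMatrix_monomialVector
      (totalDegree_add_le hk (.inr (.inl hq))) (hx.2.1 q hq)).smul hc)
  posSemidef_strict q hq := by
    rw [localizingMatrix, formMatrix_add, formMatrix_smul, formMatrix_smul]
    exact ((hy.posSemidef_strict q hq).smul ha).add ((posSemidef_formMatrix_monomialVector
      (totalDegree_add_le hk (.inr (.inr hq))) (hx.2.2 q hq)).smul hc)
  pairing_denominator := by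
    rw [pairing_add_right, pairing_smul_right, pairing_smul_right, hy.pairing_denominator,
      pairing_monomialVector (P.totalDegree_denominator_le.trans (by omega)), mul_one, h1]
  posSemidef_moment := by
    rw [momentMatrix, formMatrix_add, formMatrix_smul, formMatrix_smul]
    exact (hy.posSemidef_moment.smul ha).add ((posSemidef_formMatrix_monomialVector
      (by simp) (by simp)).smul hc)

/-- The optimal value of the relaxation times the denominator bounds the numerator on `K₁`. -/
theorem IsMomentMinimizer.mul_eval_le {k : ℕ} (hk : P.d₀ ≤ k) {y : TMS n (2 * k)}
    (hy : P.IsMomentMinimizer k y) {x : Fin n → ℝ} (hx : x ∈ P.K₁)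
    (ha₂ : 0 ≤ MvPolynomial.eval x P.a₂) :
    pairing P.a₁ y * MvPolynomial.eval x P.a₂ ≤ MvPolynomial.eval x P.a₁ := by
  have key : ∀ a c : ℝ, 0 ≤ a → 0 ≤ c → a + c * MvPolynomial.eval x P.a₂ = 1 →
      pairing P.a₁ y ≤ a * pairing P.a₁ y + c * MvPolynomial.eval x P.a₁ := by
    intro a c ha hc h1
    have := hy.2 _ (hy.1.smul_add_smul_monomialVector hk ha hc hx h1)
    rwa [pairing_add_right, pairing_smul_right, pairing_smul_right,
      pairing_monomialVector (P.totalDegree_numerator_le.trans (by omega))] at this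
  rcases ha₂.eq_or_lt with h0 | hpos
  -- If `a₂(x) = 0`, adding `[x]` to `y` keeps `⟨a₂, ·⟩ = 1`, so minimality forces `a₁(x) ≥ 0`.
  · have := key 1 1 zero_le_one zero_le_one (by rw [← h0]; simp)
    rw [← h0]
    linarith
  -- Otherwise compare `y` with the normalized evaluation `[x] / a₂(x)`.
  · have := key 0 (MvPolynomial.eval x P.a₂)⁻¹ le_rfl (inv_nonneg.mpr ha₂)
      (by rw [inv_mul_cancel₀ hpos.ne', zero_add])
    rw [zero_mul, zero_add, ← div_eq_inv_mul, le_div_iff₀ hpos] at this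
    exact this

end RationalProgram

end MomentRelaxation

theorem theorem5p2 {n : ℕ} (P : MomentRelaxation.RationalProgram n) (k t : ℕ)
    (hd₀t : P.d₀ ≤ t) (htk : t ≤ k)
    (ha₂ : ∀ x ∈ P.K₁, 0 ≤ MvPolynomial.eval x P.a₂)
    (y : MomentRelaxation.TMS n (2 * k)) (hy : P.IsMomentMinimizer k y)
    (hflat : P.IsFlatTruncation t y) :
    (1 ≤ P.d₀ →
      ∃ (μ : Fin (MomentRelaxation.momentMatrix t y).rank → ℝ)
        (z : Fin (MomentRelaxation.momentMatrix t y).rank → Fin n → ℝ),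
        P.IsAtomicDecomposition
          (MomentRelaxation.truncate (Nat.mul_le_mul_left 2 htk) y) μ z) ∧
    ∀ (μ : Fin (MomentRelaxation.momentMatrix t y).rank → ℝ)
      (z : Fin (MomentRelaxation.momentMatrix t y).rank → Fin n → ℝ),
      P.IsAtomicDecomposition
        (MomentRelaxation.truncate (Nat.mul_le_mul_left 2 htk) y) μ z →
      ∀ i, z i ∈ P.K → 0 < MvPolynomial.eval (z i) P.a₂ → P.IsMinimizer (z i) := by
  open MomentRelaxation MomentRelaxation.RationalProgram in
  constructor
  · intro hd₀
    have htrunc : ∀ s ≤ t, momentMatrix s (truncate (Nat.mul_le_mul_left 2 htk) y) =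
        momentMatrix s y := fun s hs =>
      formMatrix_truncate _ (by simpa using hs) y
    have hpsd : (momentMatrix t (truncate (Nat.mul_le_mul_left 2 htk) y)).PosSemidef := by
      rw [htrunc t le_rfl, momentMatrix, ← formMatrix_submatrix htk]
      exact hy.1.posSemidef_moment.submatrix _
    -- Here `d₀ ≥ 1` is essential: it gives `t - d₀ + 1 ≤ t`.
    have h := exists_atoms_of_flat (s := t - P.d₀) (by omega) _ hpsd
      (by rw [htrunc t le_rfl, htrunc _ (Nat.sub_le _ _)]; exact hflat)
    rw [htrunc t le_rfl] at h
    obtain ⟨μ, z, hμ, hyz, hsep⟩ := h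
    refine ⟨μ, z, hμ, fun j => ?_, hyz⟩
    obtain ⟨c, hc⟩ := hsep j
    exact mem_K₁_of_separating hd₀t htk hy.1 hyz hc
  · rintro μ z ⟨hμ, hz, hyz⟩ i hiK hi
    have hk := hd₀t.trans htk
    have hpair : ∀ f : MvPolynomial (Fin n) ℝ, f.totalDegree ≤ 2 * P.d₀ →
        pairing f y = ∑ j, μ j * MvPolynomial.eval (z j) f := by
      intro f hf
      have hf' : f.totalDegree ≤ 2 * t := by omega
      rw [← pairing_truncate (Nat.mul_le_mul_left 2 htk) hf', hyz, pairing_sum_right]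
      exact Finset.sum_congr rfl fun j _ => by
        rw [pairing_smul_right, pairing_monomialVector hf']
    have hnonneg : ∀ j, 0 ≤ μ j * (MvPolynomial.eval (z j) P.a₁ -
        pairing P.a₁ y * MvPolynomial.eval (z j) P.a₂) := fun j =>
      mul_nonneg (hμ j).le (sub_nonneg.mpr (hy.mul_eval_le hk (hz j) (ha₂ _ (hz j))))
    -- The sum is `⟨a₁, y⟩ - ⟨a₁, y⟩⟨a₂, y⟩`, and `⟨a₂, y⟩ = 1`.
    have hsum : ∑ j, μ j * (MvPolynomial.eval (z j) P.a₁ -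
        pairing P.a₁ y * MvPolynomial.eval (z j) P.a₂) = 0 := by
      have h2 := hpair P.a₂ P.totalDegree_denominator_le
      rw [hy.1.pairing_denominator] at h2
      simp only [mul_sub, Finset.sum_sub_distrib, mul_left_comm (μ _) (pairing _ _)]
      rw [← Finset.mul_sum, ← h2, ← hpair P.a₁ P.totalDegree_numerator_le, mul_one, sub_self]
    have hzero := (Finset.sum_eq_zero_iff_of_nonneg fun j _ => hnonneg j).mp hsum i
      (Finset.mem_univ i)
    have hval : P.objective (z i) = pairing P.a₁ y := by
      rw [objective, div_eq_iff hi.ne']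
      exact sub_eq_zero.mp ((mul_eq_zero.mp hzero).resolve_left (hμ i).ne')
    refine ⟨hiK, hi.ne', fun x hx hx0 => ?_⟩
    have hx1 := K_subset_K₁ hx
    rw [hval, objective, le_div_iff₀ ((ha₂ x hx1).lt_of_ne' hx0)]
    exact hy.mul_eval_le hk hx1 (ha₂ x hx1)
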